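/- Let $n\ge 2$, let $s_a=(a,a+1)$ be the adjacent transpositions (products are compositions), put $s_{i,j}=s_is_{i-1}\cdots s_j$ if $j\le i$ and let $s_{i,j}$ be the empty word otherwise. Every element of $S_m$ is represented by exactly one word $s_{1,i_1}s_{2,i_2}\cdots s_{m-1,i_{m-1}}$ with $1\le i_j\le j+1$ for all $j$, its normal form; for a word $w$ in $s_1,\dots,s_{m-1}$ let $[w]$ be the normal form of the element it represents. A word is reduced if no shorter word represents the same element. Let $s_a$ also act on $\mathbb{Z}[x_1,x_2,\dots]$ by interchanging $x_a$ and $x_{a+1}$, let $\partial_a f=(f-s_af)/(x_a-x_{a+1})$, $\partial_w=\partial_{a_1}\cdots\partial_{a_t}$ for a word $w=s_{a_1}\cdots s_{a_t}$, $w_0^n=s_{1,1}s_{2,1}\cdots s_{n-1,1}$, and for $w\in S_n$ let $\mathfrak S_w=\partial_{[w^{-1}w_0^n]}(x_1^{n-1}x_2^{n-2}\cdots x_{n-1})$ be the Schubert polynomial; in particular $\mathfrak S_{w_0^n}=x_1^{n-1}x_2^{n-2}\cdots x_{n-1}$. For $m\ge 2$, a normal form $v=s_{1,i_1}\cdots s_{m-1,i_{m-1}}\in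 S_m$ and $J\subseteq\{l\in[1,m-2] : i_l\le l\}$, let $\delta_q=s_q$ if $q\in J$, and, if $q\in[1,m-1]\setminus J$, let $\delta_q=\partial_q$ when $i_q\le q$ and $\delta_q=\mathrm{id}$ when $i_q=q+1$; put $$X^v_J=\delta_1(x_1\,\delta_2(x_2\cdots\delta_{m-1}(x_{m-1})\cdots)).$$ Let $r_q=q$ for $q\in J$ and $r_q=q-1$ for $q\in[1,m-1]\setminus J$. If the word $s_{r_1,i_1}\cdots s_{r_{m-1},i_{m-1}}$ is reduced and $X^v_J\ne 0$, then $v(J)$ is defined as the normal form $[s_{r_1,i_1}\cdots s_{r_{m-1},i_{m-1}}]\in S_{m-1}$; otherwise $v(J)$ is undefined. Successively, $u(J_{n-1},\dots,J_l)=\bigl(u(J_{n-1},\dots,J_{l+1})\bigr)(J_l)$, where $J_l$ ranges over the admissible subsets for $u(J_{n-1},\dots,J_{l+1})\in S_{l+1}$. **Theorem.** For every $u=s_{1,i_1}\cdots s_{n-1,i_{n-1}}\in S_n$ in normal form, the polynomial $\partial_u\mathfrak S_{w_0^n}=\partial_u(x_1^{n-1}x_2^{n-2}\cdots x_{n-1})$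 is the Schubert polynomial of $w_0^nu^{-1}$, and $$\partial_u\mathfrak S_{w_0^n}=\sum_{J_{n-1},\dots,J_1}X^{u}_{J_{n-1}}X^{u(J_{n-1})}_{J_{n-2}}\cdots X^{u(J_{n-1},\dots,J_2)}_{J_1},$$ where the sum is over all $(J_{n-1},\dots,J_1)$ such that $u(J_{n-1},\dots,J_l)$ is defined for every $1\le l\le n-1$. For every $J\subseteq\{l\in[1,n-2]: i_l\le l\}$ the polynomial $X^u_J$ is either $0$ or a squarefree monomial in $x_1,\dots,x_{n-1}$ with coefficient $1$ (possibly the monomial $1$). In every summand of the formula the factor $X^{u(J_{n-1},\dots,J_{l+1})}_{J_l}$ is a squarefree monomial in $x_1,\dots,x_l$ with coefficient $1$, for each $1\le l\le n-1$ (for $l=n-1$ this is $X^u_{J_{n-1}}$). Hence all coefficients of $\partial_u\mathfrak S_{w_0^n}$ are nonnegative. -/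

import Mathlib

open scoped BigOperators

namespace SchubertGS

/-! Polynomials in `x₁, x₂, …` over `ℤ` (the variable with index `0` is never used), so that
`ℤ[x₁, …, xₙ]` sits inside one fixed ring for all `n`. -/

abbrev Poly := MvPolynomial ℕ ℤ

/-- `s_a f`: interchange `x_a` and `x_{a+1}` in `f`. -/
noncomputable def interchange (a : ℕ) (f : Poly) : Poly :=
  MvPolynomial.rename (Equiv.swap a (a + 1)) f

theorem dvd_sub_interchange (a : ℕ) (f : Poly) :
    (MvPolynomial.X a - MvPolynomial.X (a + 1) : Poly) ∣ f - interchange a f := by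
  induction f using MvPolynomial.induction_on with
  | C r => simp [interchange]
  | add p q hp hq =>
    have h : p + q - interchange a (p + q)
        = (p - interchange a p) + (q - interchange a q) := by
      simp only [interchange, map_add]; ring
    rw [h]; exact dvd_add hp hq
  | mul_X p b hp =>
    have h : p * MvPolynomial.X b - interchange a (p * MvPolynomial.X b)
        = (p - interchange a p) * MvPolynomial.X b
          + interchange a p * (MvPolynomial.X b - MvPolynomial.X (Equiv.swap a (a + 1) b)) := by
      simp only [interchange, map_mul, MvPolynomial.rename_X]; ring
    rw [h]
    refine dvd_add (Dvd.dvd.mul_right hp _) (Dvd.dvd.mul_left ?_ _)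
    by_cases h1 : b = a
    · subst h1; rw [Equiv.swap_apply_left]
    · by_cases h2 : b = a + 1
      · subst h2; rw [Equiv.swap_apply_right]
        exact ⟨-1, by ring⟩
      · rw [Equiv.swap_apply_of_ne_of_ne h1 h2, sub_self]; exact dvd_zero _

/-- The divided difference `∂_a f = (f - s_a f) / (x_a - x_{a+1})` (exact division in the
polynomial ring, which is a domain). -/
noncomputable def divDiff (a : ℕ) (f : Poly) : Poly :=
  Classical.choose (dvd_sub_interchange a f)

theorem divDiff_spec (a : ℕ) (f : Poly) :
    f - interchange a f
      = (MvPolynomial.X a - MvPolynomial.X (a + 1)) * divDiff a f :=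
  Classical.choose_spec (dvd_sub_interchange a f)

/-! Words in the generators: the letter `s_a` is recorded as the number `a`. -/

/-- `∂_w = ∂_{a₁} ∂_{a₂} ⋯ ∂_{a_t}` for the word `w = s_{a₁} s_{a₂} ⋯ s_{a_t}`. -/
noncomputable def divDiffWord (w : List ℕ) (f : Poly) : Poly :=
  w.foldr divDiff f

/-- The permutation represented by a word: the product (composition) of the adjacent
transpositions `(a, a+1)`. -/
def wordPerm (w : List ℕ) : Equiv.Perm ℕ :=
  (w.map fun a => Equiv.swap a (a + 1)).prod

/-- Membership in `S_n`, the permutations of `{1, …, n}`, extended by the identity. -/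
def InSym (n : ℕ) (π : Equiv.Perm ℕ) : Prop :=
  ∀ a, a ∉ Finset.Icc 1 n → π a = a

/-- `w` is a word of minimal length among the words in `s_1, …, s_{n-1}` representing the same
element of `S_n`. -/
def IsReduced (n : ℕ) (w : List ℕ) : Prop :=
  ∀ v : List ℕ, (∀ a ∈ v, a ∈ Finset.Icc 1 (n - 1)) → wordPerm v = wordPerm w →
    w.length ≤ v.length

/-- The word `s_{i,j} = s_i s_{i-1} ⋯ s_j` if `j ≤ i`, and the empty word otherwise. -/
def descWord (i j : ℕ) : List ℕ :=
  (List.range' j (i + 1 - j)).reverse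

/-- The index sequences `i_1, …, i_{n-1}` of the normal forms: `1 ≤ i_j ≤ j + 1`.
Only the values at `1, …, n - 1` of the function matter. -/
def IsNormalForm (n : ℕ) (i : ℕ → ℕ) : Prop :=
  ∀ j ∈ Finset.Icc 1 (n - 1), 1 ≤ i j ∧ i j ≤ j + 1

/-- The word `s_{r_1,i_1} s_{r_2,i_2} ⋯ s_{r_{n-1},i_{n-1}}`. -/
def codeWord (n : ℕ) (r i : ℕ → ℕ) : List ℕ :=
  (List.range' 1 (n - 1)).flatMap fun q => descWord (r q) (i q)

/-- The word `s_{1,i_1} s_{2,i_2} ⋯ s_{n-1,i_{n-1}}`. -/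
def nfWord (n : ℕ) (i : ℕ → ℕ) : List ℕ :=
  codeWord n (fun q => q) i

/-- The index sequence of the normal form of an element of `S_n`; it exists and its values at
`1, …, n - 1` are unique, see `normalForm_spec` and `normalForm_unique`. -/
noncomputable def normalForm (n : ℕ) (π : Equiv.Perm ℕ) : ℕ → ℕ :=
  Classical.epsilon fun i => IsNormalForm n i ∧ wordPerm (nfWord n i) = π

theorem wordPerm_append (v w : List ℕ) : wordPerm (v ++ w) = wordPerm v * wordPerm w := by
  simp [wordPerm]

theorem inSym_mul {n : ℕ} {π ρ : Equiv.Perm ℕ} (h : InSym n π) (k : InSym n ρ) :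
    InSym n (π * ρ) := by
  intro a ha
  rw [Equiv.Perm.mul_apply, k a ha, h a ha]

theorem inSym_inv {n : ℕ} {π : Equiv.Perm ℕ} (h : InSym n π) : InSym n π⁻¹ := by
  intro a ha
  rw [Equiv.Perm.inv_eq_iff_eq, h a ha]

theorem inSym_wordPerm (n : ℕ) (w : List ℕ) (hw : ∀ a ∈ w, 1 ≤ a ∧ a < n) :
    InSym n (wordPerm w) := by
  induction w with
  | nil => intro a _; simp [wordPerm]
  | cons b w ih =>
    have h : wordPerm (b :: w) = Equiv.swap b (b + 1) * wordPerm w := by simp [wordPerm]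
    rw [h]
    refine inSym_mul ?_ (ih fun a ha => hw a (List.mem_cons_of_mem _ ha))
    intro a ha
    have hb := hw b List.mem_cons_self
    rw [Finset.mem_Icc] at ha
    exact Equiv.swap_apply_of_ne_of_ne (by omega) (by omega)

theorem mem_descWord {a i j : ℕ} : a ∈ descWord i j ↔ j ≤ a ∧ a ≤ i := by
  simp only [descWord, List.mem_reverse, List.mem_range'_1]; omega

theorem descWord_succ {m j : ℕ} (h : j ≤ m + 1) :
    descWord (m + 1) j = (m + 1) :: descWord m j := by
  have e : m + 1 + 1 - j = (m + 1 - j) + 1 := by omega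
  have e2 : j + (m + 1 - j) = m + 1 := by omega
  rw [descWord, e, List.range'_1_concat, List.reverse_append, e2]
  rfl

theorem wordPerm_descWord_apply {m j : ℕ} (hj : 1 ≤ j) (h : j ≤ m + 1) :
    wordPerm (descWord m j) j = m + 1 := by
  induction m with
  | zero =>
    obtain rfl : j = 1 := by omega
    simp [descWord, wordPerm]
  | succ m ih =>
    by_cases hjm : j ≤ m + 1
    · have e : wordPerm (descWord (m + 1) j)
          = Equiv.swap (m + 1) (m + 1 + 1) * wordPerm (descWord m j) := by
        rw [descWord_succ hjm]; simp [wordPerm]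
      rw [e, Equiv.Perm.mul_apply, ih hjm, Equiv.swap_apply_left]
    · obtain rfl : j = m + 1 + 1 := by omega
      simp [descWord, wordPerm]

theorem nfWord_succ (m : ℕ) (i : ℕ → ℕ) :
    nfWord (m + 2) i = nfWord (m + 1) i ++ descWord (m + 1) (i (m + 1)) := by
  have e : m + 2 - 1 = m + 1 := rfl
  have e' : m + 1 - 1 = m := rfl
  rw [nfWord, nfWord, codeWord, codeWord, e, e', List.range'_1_concat, List.flatMap_append,
    Nat.add_comm 1 m]
  simp

theorem inSym_nfWord (n : ℕ) (i : ℕ → ℕ) (hi : IsNormalForm n i) :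
    InSym n (wordPerm (nfWord n i)) := by
  refine inSym_wordPerm n _ fun a ha => ?_
  simp only [nfWord, codeWord, List.mem_flatMap, List.mem_range'_1, mem_descWord] at ha
  obtain ⟨q, hq, h1, h2⟩ := ha
  have := (hi q (Finset.mem_Icc.2 (by omega))).1
  omega

theorem exists_normalForm (n : ℕ) (π : Equiv.Perm ℕ) (hπ : InSym n π) :
    ∃ i, IsNormalForm n i ∧ wordPerm (nfWord n i) = π := by
  match n with
  | 0 =>
    refine ⟨fun _ => 0, fun j hj => by simp at hj, ?_⟩
    ext a; rw [hπ a (by simp)]; simp [nfWord, codeWord, wordPerm]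
  | 1 =>
    refine ⟨fun _ => 0, fun j hj => by simp at hj, ?_⟩
    have h : ∀ a, a ≠ 1 → π a = a := fun a ha => hπ a (by simp [ha])
    have h1 : π 1 = 1 := by
      by_contra hne
      exact hne (π.injective (h _ hne))
    ext a
    by_cases ha : a = 1
    · subst ha; simp [nfWord, codeWord, wordPerm, h1]
    · simp [nfWord, codeWord, wordPerm, h a ha]
  | m + 2 =>
    set j := π⁻¹ (m + 2) with hjdef
    have hπj : π j = m + 2 := by simp [hjdef]
    have hj : 1 ≤ j ∧ j ≤ m + 2 := by
      by_contra hne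
      have := hπ j (by rwa [Finset.mem_Icc])
      omega
    set τ := wordPerm (descWord (m + 1) j) with hτ
    have hτS : InSym (m + 2) τ := by
      refine inSym_wordPerm _ _ fun a ha => ?_
      rw [mem_descWord] at ha; omega
    have hτj : τ j = m + 2 := wordPerm_descWord_apply hj.1 hj.2
    have hS : InSym (m + 1) (π * τ⁻¹) := by
      intro a ha
      by_cases ham : a = m + 2
      · have : τ⁻¹ a = j := by rw [Equiv.Perm.inv_eq_iff_eq, hτj, ham]
        rw [Equiv.Perm.mul_apply, this, hπj, ham]
      · refine inSym_mul hπ (inSym_inv hτS) a ?_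
        rw [Finset.mem_Icc] at ha ⊢; omega
    obtain ⟨i, hi, hiw⟩ := exists_normalForm (m + 1) _ hS
    refine ⟨Function.update i (m + 1) j, ?_, ?_⟩
    · intro k hk
      rw [Finset.mem_Icc] at hk
      by_cases hkm : k = m + 1
      · subst hkm; rw [Function.update_self]; exact hj
      · rw [Function.update_of_ne hkm]; exact hi k (Finset.mem_Icc.2 (by omega))
    · have e : nfWord (m + 1) (Function.update i (m + 1) j) = nfWord (m + 1) i := by
        unfold nfWord codeWord
        apply List.flatMap_congr
        intro q hq
        rw [List.mem_range'_1] at hq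
        rw [Function.update_of_ne (by omega)]
      rw [nfWord_succ, e, Function.update_self, wordPerm_append, hiw, ← hτ]
      simp

theorem normalForm_spec (n : ℕ) (π : Equiv.Perm ℕ) (hπ : InSym n π) :
    IsNormalForm n (normalForm n π) ∧ wordPerm (nfWord n (normalForm n π)) = π :=
  Classical.epsilon_spec (exists_normalForm n π hπ)

theorem normalForm_unique (n : ℕ) (i k : ℕ → ℕ) (hi : IsNormalForm n i) (hk : IsNormalForm n k)
    (h : wordPerm (nfWord n i) = wordPerm (nfWord n k)) :
    ∀ j ∈ Finset.Icc 1 (n - 1), i j = k j := by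
  match n with
  | 0 => intro j hj; simp at hj
  | 1 => intro j hj; simp at hj
  | m + 2 =>
    have hi' : IsNormalForm (m + 1) i := fun j hj => hi j (by
      rw [Finset.mem_Icc] at hj ⊢; omega)
    have hk' : IsNormalForm (m + 1) k := fun j hj => hk j (by
      rw [Finset.mem_Icc] at hj ⊢; omega)
    have key : ∀ l : ℕ → ℕ, IsNormalForm (m + 2) l → IsNormalForm (m + 1) l →
        wordPerm (nfWord (m + 2) l) (l (m + 1)) = m + 2 := by
      intro l hl hl'
      have hb := hl (m + 1) (by simp)
      rw [nfWord_succ, wordPerm_append, Equiv.Perm.mul_apply,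
        wordPerm_descWord_apply hb.1 hb.2]
      exact inSym_nfWord _ l hl' _ (by simp)
    have top : i (m + 1) = k (m + 1) := by
      apply (wordPerm (nfWord (m + 2) i)).injective
      rw [key i hi hi', h, key k hk hk']
    rw [nfWord_succ, nfWord_succ, wordPerm_append, wordPerm_append, top] at h
    have ih := normalForm_unique (m + 1) i k hi' hk' (mul_right_cancel h)
    intro j hj
    rw [Finset.mem_Icc] at hj
    by_cases hjm : j = m + 1
    · rw [hjm, top]
    · exact ih j (Finset.mem_Icc.2 (by omega))

/-! Schubert polynomials. -/

/-- `x_1^{n-1} x_2^{n-2} ⋯ x_{n-1}`. -/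
noncomputable def staircase (n : ℕ) : Poly :=
  ∏ k ∈ Finset.Icc 1 (n - 1), MvPolynomial.X k ^ (n - k)

/-- `w_0^n = s_{1,1} s_{2,1} ⋯ s_{n-1,1}`. -/
def longest (n : ℕ) : Equiv.Perm ℕ :=
  wordPerm (nfWord n fun _ => 1)

/-- The Schubert polynomial of `w ∈ S_n`:
`∂_{[w⁻¹ w_0^n]} (x_1^{n-1} x_2^{n-2} ⋯ x_{n-1})`. -/
noncomputable def schubert (n : ℕ) (w : Equiv.Perm ℕ) : Poly :=
  divDiffWord (nfWord n (normalForm n (w⁻¹ * longest n))) (staircase n)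

theorem schubert_longest (n : ℕ) : schubert n (longest n) = staircase n := by
  have hS : InSym n (1 : Equiv.Perm ℕ) := fun a _ => rfl
  obtain ⟨h1, h2⟩ := normalForm_spec n 1 hS
  have hid : IsNormalForm n (fun j => j + 1) := fun j _ => ⟨by simp, by simp⟩
  have hw : nfWord n (fun j => j + 1) = [] := by
    simp [nfWord, codeWord, descWord, List.flatMap_eq_nil_iff]
  have hu := normalForm_unique n _ _ h1 hid (by rw [h2, hw]; simp [wordPerm])
  have e : nfWord n (normalForm n 1) = [] := by
    rw [← hw]
    unfold nfWord codeWord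
    apply List.flatMap_congr
    intro q hq
    rw [List.mem_range'_1] at hq
    rw [hu q (Finset.mem_Icc.2 (by omega))]
  rw [schubert, inv_mul_cancel, e]
  rfl

/-! The objects in the formula. A normal form `u = s_{1,i_1} ⋯ s_{n-1,i_{n-1}} ∈ S_n` is given by
`n` and its index sequence, which is also called `u`. -/

/-- `{l ∈ [1, n-2] | i_l ≤ l}`, whose subsets are the admissible `J_{n-1}`. -/
def allowed (n : ℕ) (u : ℕ → ℕ) : Finset ℕ :=
  (Finset.Icc 1 (n - 2)).filter fun l => u l ≤ l

/-- The operator `δ^u_{J,q}`: `s_q` if `q ∈ J`; for `q ∉ J` it is `∂_q` if `i_q ≤ q`, and the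
identity otherwise. -/
noncomputable def delta (u : ℕ → ℕ) (J : Finset ℕ) (q : ℕ) (f : Poly) : Poly :=
  if q ∈ J then interchange q f else if u q ≤ q then divDiff q f else f

/-- `X^u_J = δ_1 (x_1 (δ_2 (x_2 (⋯ δ_{n-1} (x_{n-1})))))`. -/
noncomputable def monX (n : ℕ) (u : ℕ → ℕ) (J : Finset ℕ) : Poly :=
  (List.range' 1 (n - 1)).foldr (fun q f => delta u J q (MvPolynomial.X q * f)) 1

/-- The word `s_{r_1,i_1} ⋯ s_{r_{n-1},i_{n-1}}` with `r_q = q` for `q ∈ J` and `r_q = q - 1`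
otherwise. -/
def cutWord (n : ℕ) (u : ℕ → ℕ) (J : Finset ℕ) : List ℕ :=
  codeWord n (fun q => if q ∈ J then q else q - 1) u

open Classical in
/-- `u(J)`, an element of `S_{n-1}` in normal form; `none` means "undefined". -/
noncomputable def cut (n : ℕ) (u : ℕ → ℕ) (J : Finset ℕ) : Option (ℕ → ℕ) :=
  if J ⊆ allowed n u ∧ IsReduced n (cutWord n u J) ∧ monX n u J ≠ 0 then
    some (normalForm (n - 1) (wordPerm (cutWord n u J)))
  else none

/-- `u(J_{n-1}, J_{n-2}, …)`: successive cuts along the listed sets; every cut lowers `n` by one,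
and the empty list gives `u` itself. -/
noncomputable def cutList : ℕ → (ℕ → ℕ) → List (Finset ℕ) → Option (ℕ → ℕ)
  | _, u, [] => some u
  | n, u, J :: L => (cut n u J).bind fun v => cutList (n - 1) v L

/-- The sequences `(J_{n-1}, …, J_1)` such that `u(J_{n-1}, …, J_l)` is defined for all
`1 ≤ l ≤ n - 1`. The entry `J k` of the tuple, `k = 0, …, n - 2`, is the set `J_{n-1-k}`. -/
noncomputable def chains (n : ℕ) (u : ℕ → ℕ) : Finset (Fin (n - 1) → Finset ℕ) :=
  (Fintype.piFinset fun _ => (Finset.Icc 1 (n - 2)).powerset).filter fun J =>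
    ∀ k : Fin (n - 1), (cutList n u ((List.ofFn J).take (k + 1))).isSome = true

/-- The factor `X^{u(J_{n-1}, …, J_{n-k})}_{J_{n-1-k}}`, where `u(J_{n-1}, …, J_{n-k}) ∈ S_{n-k}`;
the default value `0` is not used for the members of `chains n u`. -/
noncomputable def factor (n : ℕ) (u : ℕ → ℕ) (J : Fin (n - 1) → Finset ℕ) (k : Fin (n - 1)) :
    Poly :=
  (cutList n u ((List.ofFn J).take k)).elim 0 fun v => monX (n - k) v (J k)

end SchubertGS

open SchubertGS

namespace SchubertGS

/-! ### Calculus of divided differences -/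

/-! The formula comes from peeling off one rank at a time. Since `staircase (m + 1)` is $x_1\cdots
x_m$ times `staircase m`, the blocks of $u$ are applied from the last to the first, and the stray
factor $x_1\cdots x_m$ is consumed one variable per block. In the block $s_q\cdots s_{i_q}$ all
letters but $s_q$ treat what is left of this factor as a scalar, so only $\partial_q$ needs the
Leibniz rule. It offers two terms: $\partial_q$ hits the collected monomial and the block loses its
top letter ($q\notin J$), or $s_q$ acts on the monomial and the block stays whole ($q\in J$).
Summing over all choices gives `divDiffWord_nfWord_staircase_succ`, where `monX` collects the
monomials and `cutWord` the surviving letters.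

The cut words must then be put back into normal form. By the nil-Coxeter relations, every word can
be rewritten to its normal form either with the same length and operator, or with a loss of length,
in which case its operator is zero (`exists_nfWord_of_word`). So words that are not reduced
contribute nothing, and reduced ones may be replaced by normal forms in the next smaller symmetric
group. Iterating (`sum_chains_succ`) yields the sum over chains.

Each `monX` is zero or a squarefree monomial because $\partial_q$ applied to $x_q$ times a
squarefree monomial $p$ in later variables gives $p$ if $x_{q+1}$ is absent from $p$, and zero
otherwise. Nonnegativity follows. -/

theorem X_sub_X_succ_ne_zero (a : ℕ) :
    (MvPolynomial.X a - MvPolynomial.X (a + 1) : Poly) ≠ 0 := by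
  rw [sub_ne_zero]
  intro h
  have := MvPolynomial.X_injective h
  omega

theorem X_sub_X_add_two_ne_zero (a : ℕ) :
    (MvPolynomial.X a - MvPolynomial.X (a + 2) : Poly) ≠ 0 := by
  rw [sub_ne_zero]
  intro h
  have := MvPolynomial.X_injective h
  omega

/-- The quotient in a domain is unique. As `divDiff` is a chosen witness, its values are computed by
checking this identity. -/
theorem divDiff_eq_of {a : ℕ} {f g : Poly}
    (h : f - interchange a f = (MvPolynomial.X a - MvPolynomial.X (a + 1)) * g) :
    divDiff a f = g :=
  mul_left_cancel₀ (X_sub_X_succ_ne_zero a) ((divDiff_spec a f).symm.trans h)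

theorem interchange_add (a : ℕ) (f g : Poly) :
    interchange a (f + g) = interchange a f + interchange a g := map_add _ _ _

theorem interchange_sub (a : ℕ) (f g : Poly) :
    interchange a (f - g) = interchange a f - interchange a g := map_sub _ _ _

theorem interchange_mul (a : ℕ) (f g : Poly) :
    interchange a (f * g) = interchange a f * interchange a g := map_mul _ _ _

theorem interchange_one (a : ℕ) : interchange a 1 = 1 := map_one _

theorem interchange_X (a b : ℕ) :
    interchange a (MvPolynomial.X b) = MvPolynomial.X (Equiv.swap a (a + 1) b) :=
  MvPolynomial.rename_X _ _

theorem interchange_X_left (a : ℕ) :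
    interchange a (MvPolynomial.X a) = MvPolynomial.X (a + 1) := by
  rw [interchange_X, Equiv.swap_apply_left]

theorem interchange_X_right (a : ℕ) :
    interchange a (MvPolynomial.X (a + 1)) = MvPolynomial.X a := by
  rw [interchange_X, Equiv.swap_apply_right]

theorem interchange_X_of_ne {a b : ℕ} (h : b ≠ a) (h' : b ≠ a + 1) :
    interchange a (MvPolynomial.X b) = MvPolynomial.X b := by
  rw [interchange_X, Equiv.swap_apply_of_ne_of_ne h h']

theorem interchange_interchange (a : ℕ) (f : Poly) : interchange a (interchange a f) = f := by
  rw [interchange, interchange, MvPolynomial.rename_rename]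
  have : (Equiv.swap a (a + 1) : ℕ → ℕ) ∘ (Equiv.swap a (a + 1)) = id := by
    ext x; simp
  rw [this, MvPolynomial.rename_id_apply]

theorem swap_mul_swap_comm {a b : ℕ} (h : a + 2 ≤ b) :
    Equiv.swap a (a + 1) * Equiv.swap b (b + 1) = Equiv.swap b (b + 1) * Equiv.swap a (a + 1) := by
  apply Equiv.Perm.Disjoint.commute
  intro x
  by_cases h1 : x = a ∨ x = a + 1
  · right; exact Equiv.swap_apply_of_ne_of_ne (by omega) (by omega)
  · left; exact Equiv.swap_apply_of_ne_of_ne (by omega) (by omega)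

theorem swap_braid (a : ℕ) :
    Equiv.swap a (a + 1) * Equiv.swap (a + 1) (a + 2) * Equiv.swap a (a + 1)
      = Equiv.swap (a + 1) (a + 2) * Equiv.swap a (a + 1) * Equiv.swap (a + 1) (a + 2) := by
  rw [Equiv.swap_mul_swap_mul_swap (by omega) (by omega), Equiv.swap_comm a (a + 1),
    Equiv.swap_comm (a + 1) (a + 2), Equiv.swap_mul_swap_mul_swap (by omega) (by omega),
    Equiv.swap_comm]

theorem interchange_comm {a b : ℕ} (h : a + 2 ≤ b) (f : Poly) :
    interchange a (interchange b f) = interchange b (interchange a f) := by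
  simp only [interchange, MvPolynomial.rename_rename, ← Equiv.Perm.coe_mul]
  rw [swap_mul_swap_comm h]

theorem interchange_braid (a : ℕ) (f : Poly) :
    interchange a (interchange (a + 1) (interchange a f))
      = interchange (a + 1) (interchange a (interchange (a + 1) f)) := by
  simp only [interchange, MvPolynomial.rename_rename, ← Equiv.Perm.coe_mul]
  rw [← mul_assoc, ← mul_assoc, swap_braid]

theorem divDiff_eq_zero_of_interchange {a : ℕ} {f : Poly} (h : interchange a f = f) :
    divDiff a f = 0 :=
  divDiff_eq_of (by rw [h]; ring)

theorem divDiff_add (a : ℕ) (f g : Poly) : divDiff a (f + g) = divDiff a f + divDiff a g := by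
  apply divDiff_eq_of
  rw [mul_add, ← divDiff_spec, ← divDiff_spec, interchange_add]
  ring

theorem divDiff_zero (a : ℕ) : divDiff a 0 = 0 :=
  divDiff_eq_zero_of_interchange (map_zero _)

theorem divDiff_mul (a : ℕ) (f g : Poly) :
    divDiff a (f * g) = divDiff a f * g + interchange a f * divDiff a g := by
  apply divDiff_eq_of
  rw [interchange_mul]
  linear_combination g * divDiff_spec a f + interchange a f * divDiff_spec a g

theorem divDiff_mul_of_interchange {a : ℕ} {f : Poly} (h : interchange a f = f) (g : Poly) :
    divDiff a (f * g) = f * divDiff a g := by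
  rw [divDiff_mul, divDiff_eq_zero_of_interchange h, h, zero_mul, zero_add]

theorem divDiff_X_mul {a : ℕ} {g : Poly} (h : interchange a g = g) :
    divDiff a (MvPolynomial.X a * g) = g := by
  apply divDiff_eq_of
  rw [interchange_mul, interchange_X_left, h]
  ring

/-- Under $s_a$ both $f-s_af$ and $x_a-x_{a+1}$ change sign, so their quotient is fixed. -/
theorem interchange_divDiff (a : ℕ) (f : Poly) : interchange a (divDiff a f) = divDiff a f := by
  symm
  apply divDiff_eq_of
  have h := congrArg (interchange a) (divDiff_spec a f)
  rw [interchange_mul, interchange_sub, interchange_sub, interchange_interchange,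
    interchange_X_left, interchange_X_right] at h
  linear_combination -h

theorem divDiff_divDiff (a : ℕ) (f : Poly) : divDiff a (divDiff a f) = 0 :=
  divDiff_eq_zero_of_interchange (interchange_divDiff a f)

theorem interchange_divDiff_comm {a b : ℕ} (h : a + 2 ≤ b) (f : Poly) :
    interchange a (divDiff b f) = divDiff b (interchange a f) := by
  symm
  apply divDiff_eq_of
  have e := congrArg (interchange a) (divDiff_spec b f)
  rwa [interchange_mul, interchange_sub, interchange_sub, interchange_comm h,
    interchange_X_of_ne (by omega) (by omega), interchange_X_of_ne (by omega) (by omega)] at e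

theorem divDiff_comm {a b : ℕ} (h : a + 2 ≤ b) (f : Poly) :
    divDiff a (divDiff b f) = divDiff b (divDiff a f) := by
  apply divDiff_eq_of
  -- After clearing both denominators, the two sides are $f-s_af-s_bf+s_as_bf$.
  apply mul_left_cancel₀ (X_sub_X_succ_ne_zero b)
  have e := divDiff_spec b (divDiff a f)
  have e1 := divDiff_spec a f
  have e2 := divDiff_spec b f
  have e3 := divDiff_spec b (interchange a f)
  have e4 := congrArg (interchange b) e1
  rw [interchange_mul, interchange_sub, interchange_sub,
    interchange_X_of_ne (by omega) (by omega), interchange_X_of_ne (by omega) (by omega)] at e4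
  rw [interchange_divDiff_comm h]
  linear_combination -e2 + e3 + e1 - e4 + (MvPolynomial.X a - MvPolynomial.X (a + 1)) * e

theorem divDiff_braid (a : ℕ) (f : Poly) :
    divDiff a (divDiff (a + 1) (divDiff a f))
      = divDiff (a + 1) (divDiff a (divDiff (a + 1) f)) := by
  have s1 : interchange a (MvPolynomial.X (a + 2)) = MvPolynomial.X (a + 2) :=
    interchange_X_of_ne (by omega) (by omega)
  have t1 : interchange (a + 1) (MvPolynomial.X a) = MvPolynomial.X a :=
    interchange_X_of_ne (by omega) (by omega)
  have t2 : interchange (a + 1) (MvPolynomial.X (a + 1)) = MvPolynomial.X (a + 2) :=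
    interchange_X_left _
  have t3 : interchange (a + 1) (MvPolynomial.X (a + 2)) = MvPolynomial.X (a + 1) :=
    interchange_X_right _
  have s2 := interchange_X_left a
  have s3 := interchange_X_right a
  have two : a + 1 + 1 = a + 2 := rfl
  have p1 := divDiff_spec a f
  have p2 := divDiff_spec (a + 1) (divDiff a f)
  have p3 := divDiff_spec a (divDiff (a + 1) (divDiff a f))
  have p4 := congrArg (interchange a) p2
  have p5 := congrArg (interchange (a + 1)) p1
  have p6 := congrArg (interchange a) p5
  have q1 := divDiff_spec (a + 1) f
  have q2 := divDiff_spec a (divDiff (a + 1) f)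
  have q3 := divDiff_spec (a + 1) (divDiff a (divDiff (a + 1) f))
  have q4 := congrArg (interchange (a + 1)) q2
  have q5 := congrArg (interchange a) q1
  have q6 := congrArg (interchange (a + 1)) q5
  have br := interchange_braid a f
  simp only [interchange_mul, interchange_sub, two, s1, s2, s3, t1, t2, t3,
    interchange_divDiff] at p1 p2 p3 p4 p5 p6 q1 q2 q3 q4 q5 q6
  -- Multiplied by the Vandermonde product in $x_a,x_{a+1},x_{a+2}$, both sides become the
  -- alternating sum of $f$ over $S_3$; they differ only in how the longest element is written,
  -- which `br` settles.
  apply mul_left_cancel₀ (X_sub_X_succ_ne_zero a)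
  apply mul_left_cancel₀ (X_sub_X_succ_ne_zero (a + 1))
  apply mul_left_cancel₀ (X_sub_X_add_two_ne_zero a)
  simp only [two]
  generalize divDiff a (divDiff (a + 1) (divDiff a f)) = f3 at *
  generalize divDiff (a + 1) (divDiff a (divDiff (a + 1) f)) = g3 at *
  linear_combination
    -(MvPolynomial.X (a + 1) - MvPolynomial.X (a + 2)) *
        (MvPolynomial.X a - MvPolynomial.X (a + 2)) * p3
      - (MvPolynomial.X a - MvPolynomial.X (a + 2)) * p2
      + (MvPolynomial.X (a + 1) - MvPolynomial.X (a + 2)) * p4 - p1 + p5 - p6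
      + (MvPolynomial.X a - MvPolynomial.X (a + 1)) *
        (MvPolynomial.X a - MvPolynomial.X (a + 2)) * q3
      + (MvPolynomial.X a - MvPolynomial.X (a + 2)) * q2
      - (MvPolynomial.X a - MvPolynomial.X (a + 1)) * q4 + q1 - q5 + q6 - br

/-! ### Operators attached to words -/

theorem divDiffWord_append (v w : List ℕ) (f : Poly) :
    divDiffWord (v ++ w) f = divDiffWord v (divDiffWord w f) := by
  simp [divDiffWord]

theorem divDiffWord_cons (a : ℕ) (w : List ℕ) (f : Poly) :
    divDiffWord (a :: w) f = divDiff a (divDiffWord w f) := rfl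

theorem divDiffWord_nil (f : Poly) : divDiffWord [] f = f := rfl

theorem divDiffWord_zero (w : List ℕ) : divDiffWord w 0 = 0 := by
  induction w with
  | nil => rfl
  | cons a w ih => rw [divDiffWord_cons, ih, divDiff_zero]

theorem divDiffWord_add (w : List ℕ) (f g : Poly) :
    divDiffWord w (f + g) = divDiffWord w f + divDiffWord w g := by
  induction w with
  | nil => rfl
  | cons a w ih => simp only [divDiffWord_cons, ih, divDiff_add]

theorem divDiffWord_sum {ι : Type*} (w : List ℕ) (s : Finset ι) (f : ι → Poly) :
    divDiffWord w (∑ x ∈ s, f x) = ∑ x ∈ s, divDiffWord w (f x) :=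
  map_sum (AddMonoidHom.mk' (divDiffWord w) (divDiffWord_add w)) f s

theorem divDiffWord_mul_of_interchange {w : List ℕ} {f : Poly}
    (h : ∀ a ∈ w, interchange a f = f) (g : Poly) :
    divDiffWord w (f * g) = f * divDiffWord w g := by
  induction w with
  | nil => rfl
  | cons a w ih =>
    rw [divDiffWord_cons, ih fun b hb => h b (List.mem_cons_of_mem _ hb),
      divDiff_mul_of_interchange (h a List.mem_cons_self), divDiffWord_cons]

/-! ### Rewriting a word to its normal form -/

/-- Two words of equal length that represent the same permutation and the same operator. -/
def WordEquiv (v w : List ℕ) : Prop :=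
  v.length = w.length ∧ wordPerm v = wordPerm w ∧ ∀ f, divDiffWord v f = divDiffWord w f

theorem WordEquiv.refl (v : List ℕ) : WordEquiv v v := ⟨rfl, rfl, fun _ => rfl⟩

theorem WordEquiv.trans {u v w : List ℕ} (h : WordEquiv u v) (k : WordEquiv v w) :
    WordEquiv u w :=
  ⟨h.1.trans k.1, h.2.1.trans k.2.1, fun f => (h.2.2 f).trans (k.2.2 f)⟩

theorem WordEquiv.append {u v w x : List ℕ} (h : WordEquiv u v) (k : WordEquiv w x) :
    WordEquiv (u ++ w) (v ++ x) :=
  ⟨by simp [h.1, k.1], by rw [wordPerm_append, wordPerm_append, h.2.1, k.2.1], fun f => by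
    rw [divDiffWord_append, divDiffWord_append, k.2.2, h.2.2]⟩

theorem wordEquiv_comm {a b : ℕ} (h : a + 2 ≤ b) : WordEquiv [b, a] [a, b] :=
  ⟨rfl, by simpa [wordPerm] using (swap_mul_swap_comm h).symm, fun f => (divDiff_comm h f).symm⟩

theorem wordEquiv_braid (a : ℕ) : WordEquiv [a + 1, a, a + 1] [a, a + 1, a] :=
  ⟨rfl, by simpa [wordPerm, mul_assoc] using (swap_braid a).symm,
    fun f => (divDiff_braid a f).symm⟩

theorem descWord_eq_nil {i j : ℕ} (h : i < j) : descWord i j = [] := by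
  rw [descWord, Nat.sub_eq_zero_of_le h]; rfl

theorem descWord_pred {i j : ℕ} (h : j ≤ i + 1) (hj : 1 ≤ j) :
    descWord i (j - 1) = descWord i j ++ [j - 1] := by
  obtain ⟨j, rfl⟩ : ∃ k, j = k + 1 := ⟨j - 1, by omega⟩
  have e : i + 1 - j = (i + 1 - (j + 1)) + 1 := by omega
  simp [descWord, e, List.range'_succ]

theorem wordEquiv_descWord_comm {a i j : ℕ} (h : a + 2 ≤ j) :
    WordEquiv (descWord i j ++ [a]) (a :: descWord i j) := by
  induction i with
  | zero => rw [descWord_eq_nil (by omega)]; exact WordEquiv.refl _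
  | succ i ih =>
    by_cases hij : j ≤ i + 1
    · rw [descWord_succ hij]
      exact ((WordEquiv.refl [i + 1]).append ih).trans
        ((wordEquiv_comm (show a + 2 ≤ i + 1 by omega)).append (WordEquiv.refl (descWord i j)))
    · rw [descWord_eq_nil (by omega)]; exact WordEquiv.refl _

theorem WordEquiv.symm {v w : List ℕ} (h : WordEquiv v w) : WordEquiv w v :=
  ⟨h.1.symm, h.2.1.symm, fun f => (h.2.2 f).symm⟩

theorem wordEquiv_descWord_comm' {b i j : ℕ} (h : i + 2 ≤ b) :
    WordEquiv (descWord i j ++ [b]) (b :: descWord i j) := by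
  induction i with
  | zero =>
    rcases Nat.eq_zero_or_pos j with rfl | hj
    · exact (wordEquiv_comm h).symm
    · rw [descWord_eq_nil hj]; exact WordEquiv.refl _
  | succ i ih =>
    by_cases hij : j ≤ i + 1
    · rw [descWord_succ hij]
      exact ((WordEquiv.refl [i + 1]).append (ih (by omega))).trans
        ((wordEquiv_comm h).symm.append (WordEquiv.refl (descWord i j)))
    · rw [descWord_eq_nil (by omega)]; exact WordEquiv.refl _

/-- The letter $s_{a+1}$ moves left past $s_{a-1},\dots,s_j$, meets $s_{a+1}s_a$, turns into $s_a$
by the braid relation, and then commutes with $s_{a+2},\dots,s_i$. -/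
theorem wordEquiv_descWord_braid {a i j : ℕ} (hj : 1 ≤ j) (h : j ≤ a) (hi : a + 1 ≤ i) :
    WordEquiv (descWord i j ++ [a + 1]) (a :: descWord i j) := by
  induction i with
  | zero => omega
  | succ i ih =>
    rw [descWord_succ (by omega)]
    by_cases hai : a + 1 ≤ i
    · exact ((WordEquiv.refl [i + 1]).append (ih hai)).trans
        ((wordEquiv_comm (show a + 2 ≤ i + 1 by omega)).append (WordEquiv.refl (descWord i j)))
    · obtain ⟨k, rfl⟩ : ∃ k, i = k + 1 := ⟨i - 1, by omega⟩
      obtain rfl : a = k + 1 := by omega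
      rw [descWord_succ h]
      exact ((WordEquiv.refl [k + 2, k + 1]).append (wordEquiv_descWord_comm' le_rfl)).trans
        ((wordEquiv_braid (k + 1)).append (WordEquiv.refl (descWord k j)))

theorem nfWord_congr {n : ℕ} {i k : ℕ → ℕ} (h : ∀ j ∈ Finset.Icc 1 (n - 1), i j = k j) :
    nfWord n i = nfWord n k := by
  unfold nfWord codeWord
  apply List.flatMap_congr
  intro q hq
  rw [List.mem_range'_1] at hq
  rw [h q (Finset.mem_Icc.2 (by omega))]

theorem nfWord_update (m : ℕ) (i : ℕ → ℕ) (j : ℕ) :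
    nfWord (m + 2) (Function.update i (m + 1) j) = nfWord (m + 1) i ++ descWord (m + 1) j := by
  rw [nfWord_succ, Function.update_self]
  congr 1
  apply nfWord_congr
  intro k hk
  rw [Finset.mem_Icc] at hk
  exact Function.update_of_ne (by omega) _ _

theorem isNormalForm_update {m : ℕ} {i : ℕ → ℕ} {j : ℕ} (hi : IsNormalForm (m + 1) i)
    (hj : 1 ≤ j) (hj' : j ≤ m + 2) : IsNormalForm (m + 2) (Function.update i (m + 1) j) := by
  intro k hk
  rw [Finset.mem_Icc] at hk
  by_cases hkm : k = m + 1
  · subst hkm; rw [Function.update_self]; exact ⟨hj, hj'⟩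
  · rw [Function.update_of_ne hkm]; exact hi k (Finset.mem_Icc.2 (by omega))

theorem IsNormalForm.mono {m n : ℕ} {i : ℕ → ℕ} (h : m ≤ n) (hi : IsNormalForm n i) :
    IsNormalForm m i := fun j hj => hi j (by rw [Finset.mem_Icc] at hj ⊢; omega)

/-- The word `w` represents the same permutation as `v`, is longer, and its operator vanishes. -/
def Collapses (w v : List ℕ) : Prop :=
  wordPerm w = wordPerm v ∧ v.length < w.length ∧ ∀ f, divDiffWord w f = 0

theorem Collapses.append_right {w v : List ℕ} (h : Collapses w v) (x : List ℕ) :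
    Collapses (w ++ x) (v ++ x) :=
  ⟨by rw [wordPerm_append, wordPerm_append, h.1], by simpa using h.2.1, fun f => by
    rw [divDiffWord_append, h.2.2]⟩

theorem WordEquiv.trans_collapses {u v w : List ℕ} (h : WordEquiv u v) (k : Collapses v w) :
    Collapses u w :=
  ⟨h.2.1.trans k.1, h.1 ▸ k.2.1, fun f => (h.2.2 f).trans (k.2.2 f)⟩

theorem Collapses.trans_wordEquiv {u v w : List ℕ} (h : Collapses u v) (k : WordEquiv v w) :
    Collapses u w :=
  ⟨h.1.trans k.2.1, k.1 ▸ h.2.1, h.2.2⟩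

theorem collapses_square (v : List ℕ) (a : ℕ) : Collapses (v ++ [a] ++ [a]) v :=
  ⟨by simp [wordPerm], by simp, fun f => by
    simp [divDiffWord_append, divDiffWord_cons, divDiffWord_nil, divDiff_divDiff,
      divDiffWord_zero]⟩

/-- Multiplying a normal form by a generator on the right. -/
theorem exists_nfWord_append_letter (n : ℕ) (i : ℕ → ℕ) (hi : IsNormalForm n i) (a : ℕ)
    (ha : 1 ≤ a) (han : a < n) :
    ∃ k, IsNormalForm n k ∧
      (WordEquiv (nfWord n i ++ [a]) (nfWord n k) ∨ Collapses (nfWord n i ++ [a]) (nfWord n k)) := by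
  induction n generalizing a with
  | zero => omega
  | succ n ih =>
    obtain ⟨m, rfl⟩ : ∃ m, n = m + 1 := ⟨n - 1, by omega⟩
    have hi' : IsNormalForm (m + 1) i := hi.mono (by omega)
    obtain ⟨hj, hj'⟩ := hi (m + 1) (by simp)
    rw [nfWord_succ]
    generalize i (m + 1) = j at hj hj'
    -- a letter that passes through the last block
    have pass : ∀ b, 1 ≤ b → b < m + 1 →
        WordEquiv (descWord (m + 1) j ++ [a]) (b :: descWord (m + 1) j) →
        ∃ k, IsNormalForm (m + 2) k ∧
          (WordEquiv (nfWord (m + 1) i ++ descWord (m + 1) j ++ [a]) (nfWord (m + 2) k) ∨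
            Collapses (nfWord (m + 1) i ++ descWord (m + 1) j ++ [a]) (nfWord (m + 2) k)) := by
      intro b hb hb' hw
      obtain ⟨k, hk, hkw⟩ := ih hi' b hb hb'
      refine ⟨Function.update k (m + 1) j, isNormalForm_update hk hj hj', ?_⟩
      rw [nfWord_update]
      have e : WordEquiv (nfWord (m + 1) i ++ descWord (m + 1) j ++ [a])
          (nfWord (m + 1) i ++ [b] ++ descWord (m + 1) j) := by
        simpa using (WordEquiv.refl (nfWord (m + 1) i)).append hw
      exact hkw.imp (fun h => e.trans (h.append (WordEquiv.refl _)))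
        (fun h => e.trans_collapses (h.append_right _))
    -- Against the last block $s_{m+1}\cdots s_j$: the letter $s_{j-1}$ lengthens it, $s_j$ cancels
    -- its final letter, a smaller one commutes through, and a larger one passes with its index
    -- lowered by one. A letter that passes is below $m+1$, so the induction takes it over.
    rcases lt_trichotomy a j with h | rfl | h
    · by_cases haj : a + 1 = j
      · subst haj
        refine ⟨Function.update i (m + 1) a, isNormalForm_update hi' ha (by omega), Or.inl ?_⟩
        rw [nfWord_update, List.append_assoc]
        have := descWord_pred hj' (by omega)
        rw [Nat.add_sub_cancel] at this
        rw [this]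
        exact WordEquiv.refl _
      · exact pass a ha (by omega) (wordEquiv_descWord_comm (by omega))
    · refine ⟨Function.update i (m + 1) (a + 1),
        isNormalForm_update hi' (by omega) (by omega), Or.inr ?_⟩
      have := descWord_pred (i := m + 1) (j := a + 1) (by omega) (by omega)
      rw [Nat.add_sub_cancel] at this
      rw [nfWord_update, this, ← List.append_assoc]
      exact collapses_square _ a
    · obtain ⟨b, rfl⟩ : ∃ b, a = b + 1 := ⟨a - 1, by omega⟩
      exact pass b (by omega) (by omega) (wordEquiv_descWord_braid hj (by omega) (by omega))

theorem exists_nfWord_of_word (n : ℕ) (w : List ℕ) (hw : ∀ a ∈ w, 1 ≤ a ∧ a < n) :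
    ∃ k, IsNormalForm n k ∧ (WordEquiv w (nfWord n k) ∨ Collapses w (nfWord n k)) := by
  induction w using List.reverseRecOn with
  | nil =>
    refine ⟨fun j => j + 1, fun j _ => ⟨by simp, by simp⟩, Or.inl ?_⟩
    have : nfWord n (fun j => j + 1) = [] := by
      simp [nfWord, codeWord, descWord, List.flatMap_eq_nil_iff]
    rw [this]
    exact WordEquiv.refl _
  | append_singleton w a ih =>
    obtain ⟨k, hk, hkw⟩ := ih fun b hb => hw b (by simp [hb])
    obtain ⟨ha, han⟩ := hw a (by simp)
    obtain ⟨l, hl, hlw⟩ := exists_nfWord_append_letter n k hk a ha han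
    rcases hkw with h | h
    · have e := h.append (WordEquiv.refl [a])
      exact ⟨l, hl, hlw.imp e.trans e.trans_collapses⟩
    · refine ⟨l, hl, Or.inr ?_⟩
      have e := h.append_right [a]
      rcases hlw with h' | h'
      · exact e.trans_wordEquiv h'
      · exact ⟨e.1.trans h'.1, h'.2.1.trans e.2.1, e.2.2⟩

/-! ### Operators of reduced and of non-reduced words -/

theorem nfWord_eq_of_wordPerm_eq {n : ℕ} {i k : ℕ → ℕ} (hi : IsNormalForm n i)
    (hk : IsNormalForm n k) (h : wordPerm (nfWord n i) = wordPerm (nfWord n k)) :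
    nfWord n i = nfWord n k :=
  nfWord_congr (normalForm_unique n i k hi hk h)

theorem mem_nfWord {n : ℕ} {i : ℕ → ℕ} (hi : IsNormalForm n i) {a : ℕ} (ha : a ∈ nfWord n i) :
    1 ≤ a ∧ a < n := by
  simp only [nfWord, codeWord, List.mem_flatMap, List.mem_range'_1, mem_descWord] at ha
  obtain ⟨q, hq, h1, h2⟩ := ha
  have := (hi q (Finset.mem_Icc.2 (by omega))).1
  omega

/-- The operator of a word that is not reduced vanishes. -/
theorem divDiffWord_eq_zero_of_not_isReduced {n : ℕ} {w : List ℕ}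
    (hw : ∀ a ∈ w, 1 ≤ a ∧ a < n) (h : ¬ IsReduced n w) (f : Poly) : divDiffWord w f = 0 := by
  simp only [IsReduced, not_forall, not_le] at h
  obtain ⟨v, hv, hvw, hlt⟩ := h
  obtain ⟨k, hk, hkw⟩ := exists_nfWord_of_word n w hw
  obtain ⟨l, hl, hlv⟩ := exists_nfWord_of_word n v fun a ha => by
    have := hv a ha
    rw [Finset.mem_Icc] at this
    omega
  -- If `w` kept its length, it would be as long as the common normal form of `v` and `w`, hence no
  -- longer than `v`; so only the collapsing case remains.
  rcases hkw with h | h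
  · have e := nfWord_eq_of_wordPerm_eq hk hl (by
      rw [← h.2.1, ← hvw]; exact hlv.elim (fun h => h.2.1) (fun h => h.1))
    have e1 := h.1
    have e2 : (nfWord n l).length ≤ v.length :=
      hlv.elim (fun h => h.1.ge) (fun h => h.2.1.le)
    rw [e] at e1
    omega
  · exact h.2.2 f

/-- The operator of a reduced word is that of the normal form of its permutation. -/
theorem divDiffWord_eq_of_isReduced {m n : ℕ} (hmn : m ≤ n) {w : List ℕ}
    (hw : ∀ a ∈ w, 1 ≤ a ∧ a < m) (h : IsReduced n w) (f : Poly) :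
    divDiffWord w f = divDiffWord (nfWord m (normalForm m (wordPerm w))) f := by
  obtain ⟨k, hk, hkw⟩ := exists_nfWord_of_word m w hw
  obtain ⟨h1, h2⟩ := normalForm_spec m (wordPerm w) (inSym_wordPerm m w hw)
  have hp : wordPerm (nfWord m k) = wordPerm w :=
    hkw.elim (fun h => h.2.1.symm) (fun h => h.1.symm)
  rw [nfWord_eq_of_wordPerm_eq h1 hk (h2.trans hp.symm)]
  rcases hkw with h' | h'
  · exact h'.2.2 f
  -- A collapse would produce a shorter word for the same permutation; its letters are below `m ≤
  -- n`, so it competes in the definition of `IsReduced n`.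
  · have := h (nfWord m k) (fun a ha => Finset.mem_Icc.2 (by
      have := mem_nfWord hk ha
      omega)) hp
    have := h'.2.1
    omega

/-! ### Descending blocks applied to the staircase monomial -/

theorem interchange_prod_pow {a : ℕ} {s : Finset ℕ} {e : ℕ → ℕ} (ha : a ∈ s) (ha' : a + 1 ∈ s)
    (he : e a = e (a + 1)) :
    interchange a (∏ k ∈ s, MvPolynomial.X k ^ e k) = ∏ k ∈ s, MvPolynomial.X k ^ e k := by
  rw [interchange, map_prod]
  refine Finset.prod_equiv (Equiv.swap a (a + 1)) (fun k => ?_) fun k _ => ?_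
  · by_cases h1 : k = a
    · subst h1; simp [ha, ha']
    · by_cases h2 : k = a + 1
      · subst h2; simp [ha, ha']
      · rw [Equiv.swap_apply_of_ne_of_ne h1 h2]
  · rw [map_pow, MvPolynomial.rename_X]
    by_cases h1 : k = a
    · subst h1; simp [he]
    · by_cases h2 : k = a + 1
      · subst h2; simp [he]
      · rw [Equiv.swap_apply_of_ne_of_ne h1 h2]

/-- The additional factors have exponent zero; the index set is enlarged so that it is stable under
$s_1,\dots,s_m$. -/
theorem staircase_eq_prod (m : ℕ) :
    staircase m = ∏ k ∈ Finset.Icc 1 (m + 1), MvPolynomial.X k ^ (m - k) := by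
  refine Finset.prod_subset (Finset.Icc_subset_Icc_right (by omega)) fun k hk hk' => ?_
  rw [Finset.mem_Icc] at hk hk'
  rw [show m - k = 0 by omega, pow_zero]

theorem staircase_succ (m : ℕ) :
    staircase (m + 1) = (∏ k ∈ Finset.Icc 1 m, MvPolynomial.X k) * staircase m := by
  have h : staircase m = ∏ k ∈ Finset.Icc 1 m, MvPolynomial.X k ^ (m - k) := by
    refine Finset.prod_subset (Finset.Icc_subset_Icc_right (by omega)) fun k hk hk' => ?_
    rw [Finset.mem_Icc] at hk hk'
    rw [show m - k = 0 by omega, pow_zero]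
  rw [h, ← Finset.prod_mul_distrib]
  refine Finset.prod_congr rfl fun k hk => ?_
  rw [Finset.mem_Icc] at hk
  rw [← pow_succ', show m + 1 - k = m - k + 1 by omega]

/-- When $\partial_k$ is reached, the exponents of $x_k$ and $x_{k+1}$ still differ by exactly one,
so the monomial is $x_k$ times something symmetric in the two and $\partial_k$ just removes that
$x_k$. -/
theorem divDiffWord_descWord_staircase {m i j : ℕ} (hi : 1 ≤ i) (hij : i ≤ j + 1) (hj : j < m) :
    divDiffWord (descWord j i) (staircase m)
      = ∏ k ∈ Finset.Icc 1 (m + 1),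
          MvPolynomial.X k ^ (m - k - if i ≤ k ∧ k ≤ j then 1 else 0) := by
  have base : ∀ j, j < i → divDiffWord (descWord j i) (staircase m)
      = ∏ k ∈ Finset.Icc 1 (m + 1),
          MvPolynomial.X k ^ (m - k - if i ≤ k ∧ k ≤ j then 1 else 0) := by
    intro j hj
    rw [descWord_eq_nil hj, divDiffWord_nil, staircase_eq_prod]
    refine Finset.prod_congr rfl fun k _ => ?_
    rw [if_neg (by omega), Nat.sub_zero]
  induction j with
  | zero => exact base 0 (by omega)
  | succ j ih =>
    by_cases h : i ≤ j + 1
    · rw [descWord_succ h, divDiffWord_cons, ih h (by omega)]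
      have hmem : j + 1 ∈ Finset.Icc 1 (m + 1) := Finset.mem_Icc.2 (by omega)
      have e : (∏ k ∈ Finset.Icc 1 (m + 1),
            MvPolynomial.X k ^ (m - k - if i ≤ k ∧ k ≤ j then 1 else 0) : Poly)
          = MvPolynomial.X (j + 1) * ∏ k ∈ Finset.Icc 1 (m + 1),
            MvPolynomial.X k ^ (m - k - if i ≤ k ∧ k ≤ j + 1 then 1 else 0) := by
        rw [← Finset.mul_prod_erase _ _ hmem, ← Finset.mul_prod_erase _ _ hmem, ← mul_assoc,
          ← pow_succ']
        congr 1
        · rw [if_neg (by omega), if_pos (by omega)]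
          congr 1
          omega
        · refine Finset.prod_congr rfl fun k hk => ?_
          have := Finset.ne_of_mem_erase hk
          congr 2
          exact if_congr (by omega) rfl rfl
      rw [e]
      refine divDiff_X_mul (interchange_prod_pow hmem (Finset.mem_Icc.2 (by omega)) ?_)
      rw [if_pos (by omega), if_neg (by omega)]
      omega
    · exact base _ (by omega)

/-- When $\partial_m$ is reached, neither $x_m$ nor $x_{m+1}$ occurs. This is what excludes $m$ from
the admissible sets $J$. -/
theorem divDiffWord_descWord_staircase_eq_zero {m i : ℕ} (hi : 1 ≤ i) (him : i ≤ m) :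
    divDiffWord (descWord m i) (staircase m) = 0 := by
  obtain ⟨j, rfl⟩ : ∃ j, m = j + 1 := ⟨m - 1, by omega⟩
  rw [descWord_succ him, divDiffWord_cons,
    divDiffWord_descWord_staircase hi him (Nat.lt_succ_self j)]
  refine divDiff_eq_zero_of_interchange (interchange_prod_pow (Finset.mem_Icc.2 (by omega))
    (Finset.mem_Icc.2 (by omega)) ?_)
  omega

/-! ### The Leibniz expansion of one cut -/

theorem interchange_delta {a q : ℕ} (h : a + 2 ≤ q) (u : ℕ → ℕ) (J : Finset ℕ) (f : Poly) :
    interchange a (delta u J q f) = delta u J q (interchange a f) := by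
  unfold delta
  split_ifs
  · exact interchange_comm h f
  · exact interchange_divDiff_comm h f
  · rfl

/-- This is the scalar property needed for the Leibniz step at $q$: the monomial collected from the
blocks after $q$ is fixed by every $s_a$ with $a<q$. -/
theorem interchange_foldr_delta {a : ℕ} {l : List ℕ} (h : ∀ q ∈ l, a + 2 ≤ q) (u : ℕ → ℕ)
    (J : Finset ℕ) :
    interchange a (l.foldr (fun q f => delta u J q (MvPolynomial.X q * f)) 1)
      = l.foldr (fun q f => delta u J q (MvPolynomial.X q * f)) 1 := by
  induction l with
  | nil => exact interchange_one a
  | cons q l ih =>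
    have hq := h q List.mem_cons_self
    rw [List.foldr_cons, interchange_delta hq, interchange_mul,
      interchange_X_of_ne (by omega) (by omega), ih fun p hp => h p (List.mem_cons_of_mem _ hp)]

theorem interchange_prod_X_Icc {a q : ℕ} (ha : 1 ≤ a) (haq : a < q) :
    interchange a (∏ k ∈ Finset.Icc 1 q, MvPolynomial.X k)
      = ∏ k ∈ Finset.Icc 1 q, MvPolynomial.X k := by
  have := interchange_prod_pow (a := a) (s := Finset.Icc 1 q) (e := fun _ => 1)
    (Finset.mem_Icc.2 (by omega)) (Finset.mem_Icc.2 (by omega)) rfl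
  simpa using this

theorem prod_X_Icc_pred {q : ℕ} (hq : 1 ≤ q) :
    (∏ k ∈ Finset.Icc 1 q, MvPolynomial.X k : Poly)
      = (∏ k ∈ Finset.Icc 1 (q - 1), MvPolynomial.X k) * MvPolynomial.X q := by
  obtain ⟨p, rfl⟩ : ∃ p, q = p + 1 := ⟨q - 1, by omega⟩
  rw [Finset.prod_Icc_succ_top (by omega)]
  rfl

/-- A descending block applied to a product, by the Leibniz rule. -/
theorem divDiffWord_descWord_mul {q j : ℕ} (hj : 1 ≤ j) (hjq : j ≤ q) {g : Poly}
    (hg : ∀ a, a < q → interchange a g = g) (h : Poly) :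
    divDiffWord (descWord q j) ((∏ k ∈ Finset.Icc 1 q, MvPolynomial.X k) * (g * h))
      = (∏ k ∈ Finset.Icc 1 (q - 1), MvPolynomial.X k) *
        (divDiff q (MvPolynomial.X q * g) * divDiffWord (descWord (q - 1) j) h
          + interchange q (MvPolynomial.X q * g) * divDiffWord (descWord q j) h) := by
  have e : descWord q j = q :: descWord (q - 1) j := by
    obtain ⟨p, rfl⟩ : ∃ p, q = p + 1 := ⟨q - 1, by omega⟩
    exact descWord_succ hjq
  have h1 : divDiffWord (descWord (q - 1) j)
      ((∏ k ∈ Finset.Icc 1 q, MvPolynomial.X k) * (g * h))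
      = (∏ k ∈ Finset.Icc 1 q, MvPolynomial.X k) *
        (g * divDiffWord (descWord (q - 1) j) h) := by
    rw [divDiffWord_mul_of_interchange, divDiffWord_mul_of_interchange]
    · intro a ha
      rw [mem_descWord] at ha
      exact hg a (by omega)
    · intro a ha
      rw [mem_descWord] at ha
      exact interchange_prod_X_Icc (by omega) (by omega)
  have h2 : interchange q (∏ k ∈ Finset.Icc 1 (q - 1), MvPolynomial.X k)
      = ∏ k ∈ Finset.Icc 1 (q - 1), MvPolynomial.X k := by
    rw [interchange, map_prod]
    refine Finset.prod_congr rfl fun k hk => ?_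
    rw [Finset.mem_Icc] at hk
    exact interchange_X_of_ne (by omega) (by omega)
  rw [e, divDiffWord_cons, h1, prod_X_Icc_pred (hj.trans hjq), mul_assoc,
    divDiff_mul_of_interchange h2, ← mul_assoc (MvPolynomial.X q), divDiff_mul, divDiffWord_cons]

/-- The induction runs over the blocks from the last one down. After the blocks $q,\dots,m$ the part
$x_1\cdots x_{q-1}$ of the extra factor is still unused. Here $J$ may contain $m$; those terms are
discarded later. -/
theorem divDiffWord_flatMap_staircase {m : ℕ} {u : ℕ → ℕ} (hu : IsNormalForm (m + 1) u)
    (k q : ℕ) (hq : 1 ≤ q) (hqk : q + k = m + 1) :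
    divDiffWord ((List.range' q k).flatMap fun p => descWord p (u p)) (staircase (m + 1))
      = (∏ j ∈ Finset.Icc 1 (q - 1), MvPolynomial.X j) *
        ∑ J ∈ ((Finset.Icc q m).filter fun l => u l ≤ l).powerset,
          (List.range' q k).foldr (fun p f => delta u J p (MvPolynomial.X p * f)) 1 *
          divDiffWord ((List.range' q k).flatMap fun p =>
            descWord (if p ∈ J then p else p - 1) (u p)) (staircase m) := by
  induction k generalizing q with
  | zero =>
    obtain rfl : q = m + 1 := by omega
    simp [divDiffWord_nil, staircase_succ]
  | succ k ih =>
    obtain ⟨hu1, hu2⟩ := hu q (Finset.mem_Icc.2 (by omega))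
    rw [List.range'_succ]
    simp only [List.flatMap_cons, divDiffWord_append, List.foldr_cons]
    rw [ih (q + 1) (by omega) (by omega), Nat.add_sub_cancel, Finset.mul_sum, divDiffWord_sum]
    have hnot : ∀ J ∈ ((Finset.Icc (q + 1) m).filter fun l => u l ≤ l).powerset, q ∉ J := by
      intro J hJ hqJ
      have := Finset.mem_powerset.1 hJ hqJ
      rw [Finset.mem_filter, Finset.mem_Icc] at this
      omega
    by_cases h : u q ≤ q
    · have e : (Finset.Icc q m).filter (fun l => u l ≤ l)
          = insert q ((Finset.Icc (q + 1) m).filter fun l => u l ≤ l) := by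
        ext x
        simp only [Finset.mem_filter, Finset.mem_Icc, Finset.mem_insert]
        constructor
        · intro hx; omega
        · rintro (rfl | hx)
          · omega
          · omega
      -- The sets `J` and `insert q J` are paired: they account for the two Leibniz terms of
      -- `divDiffWord_descWord_mul`.
      rw [e, Finset.sum_powerset_insert (by simp), ← Finset.sum_add_distrib, Finset.mul_sum]
      refine Finset.sum_congr rfl fun J hJ => ?_
      have hne : ∀ p ∈ List.range' (q + 1) k, p ≠ q := by
        intro p hp
        rw [List.mem_range'_1] at hp
        omega
      have c1 : (List.range' (q + 1) k).foldr
            (fun p f => delta u (insert q J) p (MvPolynomial.X p * f)) 1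
          = (List.range' (q + 1) k).foldr (fun p f => delta u J p (MvPolynomial.X p * f)) 1 :=
        List.foldr_ext _ _ _ fun p hp f => by
          simp only [delta, Finset.mem_insert, hne p hp, false_or]
      have c2 : ((List.range' (q + 1) k).flatMap fun p =>
            descWord (if p ∈ insert q J then p else p - 1) (u p))
          = (List.range' (q + 1) k).flatMap fun p =>
            descWord (if p ∈ J then p else p - 1) (u p) :=
        List.flatMap_congr fun p hp => by
          simp only [Finset.mem_insert, hne p hp, false_or]
      rw [c1, c2, divDiffWord_descWord_mul hu1 h]
      · simp only [delta, hnot J hJ, if_false, h, if_true, Finset.mem_insert_self]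
      · intro a ha
        refine interchange_foldr_delta (fun p hp => ?_) u J
        rw [List.mem_range'_1] at hp
        omega
    · have e : (Finset.Icc q m).filter (fun l => u l ≤ l)
          = (Finset.Icc (q + 1) m).filter fun l => u l ≤ l := by
        ext x
        simp only [Finset.mem_filter, Finset.mem_Icc]
        constructor
        · rintro ⟨hx, hx'⟩
          have : x ≠ q := by rintro rfl; exact h hx'
          omega
        · intro hx; omega
      rw [e, Finset.mul_sum]
      refine Finset.sum_congr rfl fun J hJ => ?_
      simp only [delta, hnot J hJ, if_false, h]
      -- Here `u q = q + 1`, so the block is empty before and after the cut, and the variable $x_q$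
      -- simply joins the monomial.
      rw [descWord_eq_nil (by omega), descWord_eq_nil (by omega), divDiffWord_nil,
        divDiffWord_nil, prod_X_Icc_pred hq]
      ring

theorem mem_allowed_succ {m l : ℕ} {u : ℕ → ℕ} :
    l ∈ allowed (m + 1) u ↔ (1 ≤ l ∧ l < m) ∧ u l ≤ l := by
  rw [allowed, Finset.mem_filter, Finset.mem_Icc]
  omega

theorem divDiffWord_nfWord_staircase_succ {m : ℕ} {u : ℕ → ℕ}
    (hu : IsNormalForm (m + 1) u) :
    divDiffWord (nfWord (m + 1) u) (staircase (m + 1))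
      = ∑ J ∈ (allowed (m + 1) u).powerset,
          monX (m + 1) u J * divDiffWord (cutWord (m + 1) u J) (staircase m) := by
  have h := divDiffWord_flatMap_staircase hu m 1 le_rfl (Nat.add_comm 1 m)
  rw [Nat.sub_self, Finset.Icc_eq_empty (by omega), Finset.prod_empty, one_mul] at h
  refine h.trans (Finset.sum_subset (Finset.powerset_mono.2 fun l hl => ?_)
    fun J hJ hJ' => ?_).symm
  · rw [mem_allowed_succ] at hl
    rw [Finset.mem_filter, Finset.mem_Icc]
    omega
  -- A surplus set must contain $m$. Its cut word then ends in a full block topped by $s_m$, which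
  -- kills `staircase m`.
  · have hmJ : m ∈ J := by
      by_contra hm
      refine hJ' (Finset.mem_powerset.2 fun l hl => ?_)
      have hl' := Finset.mem_powerset.1 hJ hl
      rw [Finset.mem_filter, Finset.mem_Icc] at hl'
      have : l ≠ m := by rintro rfl; exact hm hl
      rw [mem_allowed_succ]
      omega
    have hm := Finset.mem_powerset.1 hJ hmJ
    rw [Finset.mem_filter, Finset.mem_Icc] at hm
    obtain ⟨k, rfl⟩ : ∃ k, m = k + 1 := ⟨m - 1, by omega⟩
    have hu1 := (hu (k + 1) (Finset.mem_Icc.2 (by omega))).1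
    rw [List.range'_1_concat, List.flatMap_append, Nat.add_comm 1 k, List.flatMap_singleton,
      if_pos hmJ, divDiffWord_append, divDiffWord_descWord_staircase_eq_zero hu1 hm.2,
      divDiffWord_zero, mul_zero]

/-! ### The factors are squarefree monomials -/

theorem interchange_prod_X (q : ℕ) (A : Finset ℕ) :
    interchange q (∏ k ∈ A, MvPolynomial.X k)
      = ∏ k ∈ A.map (Equiv.swap q (q + 1)).toEmbedding, MvPolynomial.X k := by
  rw [interchange, map_prod, Finset.prod_map]
  exact Finset.prod_congr rfl fun k _ => MvPolynomial.rename_X _ _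

/-- The bound on `J` keeps the support in range: $s_q$ may introduce $x_{q+1}$, which is allowed
only when $q$ is not the last index. -/
theorem foldr_delta_eq_zero_or_prod (u : ℕ → ℕ) (J : Finset ℕ) (k q : ℕ)
    (hJ : ∀ l ∈ J, l + 1 < q + k) :
    (List.range' q k).foldr (fun p f => delta u J p (MvPolynomial.X p * f)) 1 = 0 ∨
      ∃ A : Finset ℕ, (∀ a ∈ A, q ≤ a ∧ a < q + k) ∧
        (List.range' q k).foldr (fun p f => delta u J p (MvPolynomial.X p * f)) 1
          = ∏ a ∈ A, MvPolynomial.X a := by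
  induction k generalizing q with
  | zero => exact Or.inr ⟨∅, by simp, rfl⟩
  | succ k ih =>
    rw [List.range'_succ, List.foldr_cons]
    rcases ih (q + 1) (fun l hl => by have := hJ l hl; omega) with h | ⟨A, hA, h⟩
    · left
      rw [h, mul_zero]
      unfold delta
      split_ifs
      · exact map_zero _
      · exact divDiff_zero q
      · rfl
    · rw [h]
      have hqA : q ∉ A := fun hq => by have := hA q hq; omega
      rw [← Finset.prod_insert hqA]
      unfold delta
      split_ifs with h1 h2
      · right
        have := hJ q h1
        refine ⟨_, fun a ha => ?_, interchange_prod_X q _⟩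
        rw [Finset.mem_map_equiv, Equiv.symm_swap, Finset.mem_insert] at ha
        by_cases e1 : a = q
        · omega
        · by_cases e2 : a = q + 1
          · omega
          · rw [Equiv.swap_apply_of_ne_of_ne e1 e2] at ha
            have := ha.imp_right (hA a)
            omega
      -- With $x_{q+1}$ present the monomial is symmetric in $x_q,x_{q+1}$; without it, $\partial_q$
      -- strips off $x_q$.
      · by_cases h3 : q + 1 ∈ A
        · left
          have := interchange_prod_pow (a := q) (s := insert q A) (e := fun _ => 1)
            (Finset.mem_insert_self _ _) (Finset.mem_insert_of_mem h3) rfl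
          simp only [pow_one] at this
          exact divDiff_eq_zero_of_interchange this
        · right
          refine ⟨A, fun a ha => by have := hA a ha; omega, ?_⟩
          rw [Finset.prod_insert hqA]
          apply divDiff_X_mul
          rw [interchange, map_prod]
          refine Finset.prod_congr rfl fun a ha => ?_
          exact interchange_X_of_ne (by rintro rfl; exact hqA ha) (by rintro rfl; exact h3 ha)
      · right
        refine ⟨insert q A, fun a ha => ?_, rfl⟩
        have := (Finset.mem_insert.1 ha).imp_right (hA a)
        omega

theorem monX_eq_zero_or_prod {n : ℕ} {u : ℕ → ℕ} {J : Finset ℕ} (hJ : J ⊆ allowed n u) :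
    monX n u J = 0 ∨
      ∃ A ⊆ Finset.Icc 1 (n - 1), monX n u J = ∏ q ∈ A, MvPolynomial.X q := by
  refine (foldr_delta_eq_zero_or_prod u J (n - 1) 1 fun l hl => ?_).imp_right ?_
  · have := hJ hl
    rw [allowed, Finset.mem_filter, Finset.mem_Icc] at this
    omega
  · rintro ⟨A, hA, h⟩
    exact ⟨A, fun a ha => Finset.mem_Icc.2 (by have := hA a ha; omega), h⟩

/-! ### Chains of cuts -/

/-- A block outside `J` loses its top letter, and a block in `J` has top letter at most $m-1$, so
the cut word lives in $S_m$. -/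
theorem mem_cutWord_succ {m a : ℕ} {u : ℕ → ℕ} {J : Finset ℕ} (hu : IsNormalForm (m + 1) u)
    (hJ : J ⊆ allowed (m + 1) u) (ha : a ∈ cutWord (m + 1) u J) : 1 ≤ a ∧ a < m := by
  simp only [cutWord, codeWord, List.mem_flatMap, List.mem_range'_1, mem_descWord] at ha
  obtain ⟨q, hq, h1, h2⟩ := ha
  have h3 := (hu q (Finset.mem_Icc.2 (by omega))).1
  split_ifs at h2 with h
  · have := mem_allowed_succ.1 (hJ h)
    omega
  · omega

theorem cut_eq_some_iff {n : ℕ} {u v : ℕ → ℕ} {J : Finset ℕ} :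
    cut n u J = some v ↔ (J ⊆ allowed n u ∧ IsReduced n (cutWord n u J) ∧ monX n u J ≠ 0) ∧
      normalForm (n - 1) (wordPerm (cutWord n u J)) = v := by
  unfold cut
  split_ifs with h
  · simp [h]
  · simp [h]

theorem isNormalForm_of_cut {m : ℕ} {u v : ℕ → ℕ} {J : Finset ℕ} (hu : IsNormalForm (m + 1) u)
    (h : cut (m + 1) u J = some v) : IsNormalForm m v := by
  obtain ⟨⟨hJ, -, -⟩, rfl⟩ := cut_eq_some_iff.1 h
  exact (normalForm_spec m _ (inSym_wordPerm m _ fun a ha => mem_cutWord_succ hu hJ ha)).1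

/-- For admissible `J`, both reasons for `cut` to be undefined, a zero monomial and a non-reduced
word, make the Leibniz term vanish. -/
theorem monX_mul_divDiffWord_cutWord {m : ℕ} {u : ℕ → ℕ} {J : Finset ℕ}
    (hu : IsNormalForm (m + 1) u) (hJ : J ⊆ allowed (m + 1) u) (f : Poly) :
    monX (m + 1) u J * divDiffWord (cutWord (m + 1) u J) f
      = (cut (m + 1) u J).elim 0 fun v => monX (m + 1) u J * divDiffWord (nfWord m v) f := by
  have hw : ∀ a ∈ cutWord (m + 1) u J, 1 ≤ a ∧ a < m := fun a ha => mem_cutWord_succ hu hJ ha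
  by_cases hX : monX (m + 1) u J = 0
  · rw [cut, if_neg (by tauto), hX, zero_mul]
    rfl
  · by_cases hr : IsReduced (m + 1) (cutWord (m + 1) u J)
    · rw [cut, if_pos ⟨hJ, hr, hX⟩, divDiffWord_eq_of_isReduced (Nat.le_succ m) hw hr]
      rfl
    · rw [cut, if_neg (by tauto), divDiffWord_eq_zero_of_not_isReduced
        (fun a ha => ⟨(hw a ha).1, (hw a ha).2.trans (Nat.lt_succ_self m)⟩) hr, mul_zero]
      rfl

theorem mem_chains_iff {n : ℕ} {u : ℕ → ℕ} {J : Fin (n - 1) → Finset ℕ} :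
    J ∈ chains n u ↔ (∀ k, J k ⊆ Finset.Icc 1 (n - 2)) ∧
      ∀ k : Fin (n - 1), (cutList n u ((List.ofFn J).take (k + 1))).isSome = true := by
  simp only [chains, Finset.mem_filter, Fintype.mem_piFinset, Finset.mem_powerset]

theorem isSome_cutList_cons {n : ℕ} {u : ℕ → ℕ} {J : Finset ℕ} {L : List (Finset ℕ)} :
    (cutList n u (J :: L)).isSome = true ↔
      ∃ v, cut n u J = some v ∧ (cutList (n - 1) v L).isSome = true := by
  rw [cutList]
  cases cut n u J <;> simp

theorem isSome_cutList_take {n : ℕ} {u : ℕ → ℕ} {L : List (Finset ℕ)}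
    (h : (cutList n u L).isSome = true) (k : ℕ) : (cutList n u (L.take k)).isSome = true := by
  induction L generalizing n u k with
  | nil => simpa using h
  | cons J L ih =>
    cases k with
    | zero => rfl
    | succ k =>
      obtain ⟨v, hv, hL⟩ := isSome_cutList_cons.1 h
      exact isSome_cutList_cons.2 ⟨v, hv, ih hL k⟩

theorem subset_of_isSome_cutList {n : ℕ} {u : ℕ → ℕ} {L : List (Finset ℕ)}
    (h : (cutList n u L).isSome = true) : ∀ J ∈ L, J ⊆ Finset.Icc 1 (n - 2) := by
  induction L generalizing n u with
  | nil => simp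
  | cons J L ih =>
    obtain ⟨v, hv, hL⟩ := isSome_cutList_cons.1 h
    rintro K (_ | ⟨_, hK⟩)
    · exact (cut_eq_some_iff.1 hv).1.1.trans (Finset.filter_subset _ _)
    · exact (ih hL K hK).trans (Finset.Icc_subset_Icc_right (by omega))

theorem mem_chains_iff_isSome {n : ℕ} {u : ℕ → ℕ} {J : Fin (n - 1) → Finset ℕ} :
    J ∈ chains n u ↔ (cutList n u (List.ofFn J)).isSome = true := by
  rw [mem_chains_iff]
  constructor
  · rintro ⟨-, h⟩
    -- The last index yields the whole list as a prefix; for an empty tuple there is no index, but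
    -- the empty list is always defined.
    rcases Nat.eq_zero_or_pos (n - 1) with h0 | hpos
    · have e : List.ofFn J = [] := List.length_eq_zero_iff.1 (by rw [List.length_ofFn, h0])
      rw [e]
      rfl
    · have := h ⟨n - 1 - 1, by omega⟩
      rwa [List.take_of_length_le (by rw [List.length_ofFn]; simp only; omega)] at this
  · intro h
    exact ⟨fun k => subset_of_isSome_cutList h _ (List.mem_ofFn.2 ⟨k, rfl⟩),
      fun k => isSome_cutList_take h _⟩

theorem cons_mem_chains_iff {m : ℕ} {u : ℕ → ℕ} {J : Finset ℕ} {L : Fin m → Finset ℕ} :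
    (Fin.cons J L : Fin (m + 1) → Finset ℕ) ∈ chains (m + 2) u ↔
      ∃ v, cut (m + 2) u J = some v ∧ L ∈ chains (m + 1) v := by
  rw [mem_chains_iff_isSome]
  have e : List.ofFn (n := m + 2 - 1) (Fin.cons J L : Fin (m + 1) → Finset ℕ)
      = J :: List.ofFn L := List.ofFn_cons J L
  rw [e, isSome_cutList_cons]
  exact exists_congr fun v => and_congr_right fun _ =>
    (mem_chains_iff_isSome (n := m + 1)).symm

theorem factor_cons_zero {m : ℕ} {u : ℕ → ℕ} {J : Finset ℕ} {L : Fin m → Finset ℕ} :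
    factor (m + 2) u (Fin.cons J L : Fin (m + 1) → Finset ℕ) (0 : Fin (m + 1))
      = monX (m + 2) u J := by
  simp [factor, cutList]

theorem factor_cons_succ {m : ℕ} {u v : ℕ → ℕ} {J : Finset ℕ} {L : Fin m → Finset ℕ}
    (h : cut (m + 2) u J = some v) (k : Fin m) :
    factor (m + 2) u (Fin.cons J L : Fin (m + 1) → Finset ℕ) k.succ = factor (m + 1) v L k := by
  have e : List.ofFn (n := m + 2 - 1) (Fin.cons J L : Fin (m + 1) → Finset ℕ)
      = J :: List.ofFn L := List.ofFn_cons J L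
  have e' : m + 2 - (k.succ : Fin (m + 1)).val = m + 1 - k.val := by
    rw [Fin.val_succ]; omega
  unfold factor
  rw [e, e', Fin.val_succ, List.take_succ_cons, cutList, h]
  rfl

theorem factor_eq_prod (n : ℕ) (u : ℕ → ℕ) (J : Fin (n - 1) → Finset ℕ) (hJ : J ∈ chains n u)
    (k : Fin (n - 1)) :
    ∃ A ⊆ Finset.Icc 1 (n - 1 - k), factor n u J k = ∏ q ∈ A, MvPolynomial.X q := by
  induction n generalizing u with
  | zero => exact k.elim0
  | succ n ih =>
    cases n with
    | zero => exact k.elim0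
    | succ m =>
      obtain ⟨K, L, rfl⟩ : ∃ (K : Finset ℕ) (L : Fin m → Finset ℕ),
          J = (Fin.cons K L : Fin (m + 1) → Finset ℕ) :=
        ⟨_, _, (Fin.cons_self_tail (n := m) (α := fun _ => Finset ℕ) J).symm⟩
      obtain ⟨v, hv, hL⟩ := cons_mem_chains_iff.1 hJ
      refine Fin.cases (motive := fun k : Fin (m + 1) => ∃ A ⊆ Finset.Icc 1 (m + 1 - k.val),
        factor (m + 2) u (Fin.cons K L : Fin (m + 1) → Finset ℕ) k
          = ∏ q ∈ A, MvPolynomial.X q) ?_ (fun k => ?_) k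
      · rw [factor_cons_zero]
        obtain ⟨hK, -, hX⟩ := (cut_eq_some_iff.1 hv).1
        exact (monX_eq_zero_or_prod hK).resolve_left hX
      · rw [factor_cons_succ hv]
        obtain ⟨A, hA, h⟩ := ih v L hL k
        exact ⟨A, hA.trans (Finset.Icc_subset_Icc_right (by rw [Fin.val_succ]; omega)), h⟩

/-- A chain is its first set together with a chain for the resulting cut, so the sum over chains
obeys the recursion of `divDiffWord_nfWord_staircase_succ`. -/
theorem sum_chains_succ (m : ℕ) (u : ℕ → ℕ) :
    ∑ J ∈ chains (m + 2) u, ∏ k, factor (m + 2) u J k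
      = ∑ J ∈ (allowed (m + 2) u).powerset, (cut (m + 2) u J).elim 0 fun v =>
          monX (m + 2) u J * ∑ L ∈ chains (m + 1) v, ∏ k, factor (m + 1) v L k := by
  classical
  have hprod : ∀ (J : Finset ℕ) (v : ℕ → ℕ) (L : Fin m → Finset ℕ),
      cut (m + 2) u J = some v →
      ∏ k, factor (m + 2) u (Fin.cons J L : Fin (m + 1) → Finset ℕ) k
        = monX (m + 2) u J * ∏ k, factor (m + 1) v L k := by
    intro J v L h
    refine (Fin.prod_univ_succ (n := m) _).trans ?_
    rw [factor_cons_zero]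
    exact congrArg _ (Finset.prod_congr rfl fun k _ => factor_cons_succ h k)
  have hinner : ∀ J ∈ (allowed (m + 2) u).powerset,
      ((cut (m + 2) u J).elim 0 fun v =>
          monX (m + 2) u J * ∑ L ∈ chains (m + 1) v, ∏ k, factor (m + 1) v L k)
        = ∑ L ∈ (cut (m + 2) u J).elim ∅ fun v => chains (m + 1) v,
            ∏ k, factor (m + 2) u (Fin.cons J L : Fin (m + 1) → Finset ℕ) k := by
    intro J _
    cases h : cut (m + 2) u J with
    | none => rfl
    | some v =>
      simp only [Option.elim_some, Finset.mul_sum]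
      exact Finset.sum_congr rfl fun L _ => (hprod J v L h).symm
  -- Undefined cuts carry an empty fibre, so the dependent pairs correspond exactly to chains
  -- through `Fin.cons`.
  rw [Finset.sum_congr rfl hinner, Finset.sum_sigma']
  symm
  refine Finset.sum_bij' (fun (x : (_ : Finset ℕ) × (Fin m → Finset ℕ)) _ =>
      (Fin.cons x.1 x.2 : Fin (m + 1) → Finset ℕ))
    (fun (J : Fin (m + 1) → Finset ℕ) _ => ⟨J 0, Fin.tail J⟩) ?_ ?_ ?_ ?_ ?_
  · rintro ⟨J, L⟩ hx
    rw [Finset.mem_sigma] at hx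
    cases h : cut (m + 2) u J with
    | none => simp [h] at hx
    | some v =>
      simp only [h, Option.elim_some] at hx
      exact cons_mem_chains_iff.2 ⟨v, h, hx.2⟩
  · intro J hJ
    rw [← Fin.cons_self_tail (n := m) (α := fun _ => Finset ℕ) J] at hJ
    obtain ⟨v, hv, hL⟩ := cons_mem_chains_iff.1 hJ
    rw [Finset.mem_sigma]
    refine ⟨Finset.mem_powerset.2 (cut_eq_some_iff.1 hv).1.1, ?_⟩
    simp only [hv, Option.elim_some]
    exact hL
  · rintro ⟨J, L⟩ _
    simp
  · intro J _
    exact Fin.cons_self_tail (n := m) (α := fun _ => Finset ℕ) J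
  · intro _ _
    rfl

theorem divDiffWord_nfWord_staircase (n : ℕ) (u : ℕ → ℕ) (hu : IsNormalForm (n + 1) u) :
    divDiffWord (nfWord (n + 1) u) (staircase (n + 1))
      = ∑ J ∈ chains (n + 1) u, ∏ k, factor (n + 1) u J k := by
  induction n generalizing u with
  | zero =>
    have e : chains 1 u = {Fin.elim0} :=
      Finset.eq_singleton_iff_unique_mem.2
        ⟨mem_chains_iff_isSome.2 rfl, fun J _ => funext fun k : Fin 0 => k.elim0⟩
    rw [zero_add, e]
    simp [nfWord, codeWord, divDiffWord_nil, staircase]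
  | succ m ih =>
    rw [divDiffWord_nfWord_staircase_succ hu, sum_chains_succ]
    refine Finset.sum_congr rfl fun J hJ => ?_
    rw [monX_mul_divDiffWord_cutWord hu (Finset.mem_powerset.1 hJ)]
    cases h : cut (m + 2) u J with
    | none => rfl
    | some v =>
      simp only [Option.elim_some]
      rw [ih v (isNormalForm_of_cut hu h)]

theorem coeff_prod_X_nonneg {ι : Type*} (s : Finset ι) (A : ι → Finset ℕ) (d : ℕ →₀ ℕ) :
    0 ≤ MvPolynomial.coeff d (∏ k ∈ s, ∏ q ∈ A k, MvPolynomial.X q : Poly) := by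
  have h1 : ∀ B : Finset ℕ, (∏ q ∈ B, MvPolynomial.X q : Poly)
      = MvPolynomial.monomial (∑ q ∈ B, Finsupp.single q 1) 1 := by
    intro B
    rw [MvPolynomial.monomial_sum_one]
    rfl
  rw [Finset.prod_congr rfl fun k _ => h1 (A k), ← MvPolynomial.monomial_sum_one,
    MvPolynomial.coeff_monomial]
  split_ifs <;> simp

/-- Since $(w_0u^{-1})^{-1}w_0=u$, the definition asks for the normal form of $u$, which by
uniqueness is the given word itself. -/
theorem schubert_longest_mul_inv {n : ℕ} {u : ℕ → ℕ} (hu : IsNormalForm n u) :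
    schubert n (longest n * (wordPerm (nfWord n u))⁻¹)
      = divDiffWord (nfWord n u) (staircase n) := by
  obtain ⟨h1, h2⟩ := normalForm_spec n _ (inSym_nfWord n u hu)
  rw [schubert, mul_inv_rev, inv_inv, inv_mul_cancel_right, nfWord_eq_of_wordPerm_eq h1 hu h2]

end SchubertGS

theorem theorem2p1 (n : ℕ) (hn : 2 ≤ n) (u : ℕ → ℕ) (hu : IsNormalForm n u) :
    schubert n (longest n * (wordPerm (nfWord n u))⁻¹)
        = divDiffWord (nfWord n u) (staircase n) ∧
    divDiffWord (nfWord n u) (staircase n)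
        = ∑ J ∈ chains n u, ∏ k : Fin (n - 1), factor n u J k ∧
    (∀ J ⊆ allowed n u, monX n u J = 0 ∨
      ∃ A ⊆ Finset.Icc 1 (n - 1), monX n u J = ∏ q ∈ A, MvPolynomial.X q) ∧
    (∀ J ∈ chains n u, ∀ k : Fin (n - 1),
      ∃ A ⊆ Finset.Icc 1 (n - 1 - k), factor n u J k = ∏ q ∈ A, MvPolynomial.X q) ∧
    (∀ m, 0 ≤ MvPolynomial.coeff m (divDiffWord (nfWord n u) (staircase n))) := by
  have hsum : divDiffWord (nfWord n u) (staircase n)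
      = ∑ J ∈ chains n u, ∏ k : Fin (n - 1), factor n u J k := by
    obtain ⟨m, rfl⟩ : ∃ m, n = m + 1 := ⟨n - 1, by omega⟩
    exact divDiffWord_nfWord_staircase m u hu
  refine ⟨schubert_longest_mul_inv hu, hsum, fun J hJ => monX_eq_zero_or_prod hJ,
    fun J hJ k => factor_eq_prod n u J hJ k, fun d => ?_⟩
  rw [hsum, MvPolynomial.coeff_sum]
  refine Finset.sum_nonneg fun J hJ => ?_
  choose A _ hA using factor_eq_prod n u J hJ
  rw [Finset.prod_congr rfl fun k _ => hA k]
  exact coeff_prod_X_nonneg _ A d
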